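/- Let $(M,\kappa)$ be a connected $2n$-dimensional symplectic manifold. For a smooth field of endomorphisms $R\in \mathrm{End}(TM)$ let $$N_R(X,Y)=[RX,RY]+R^2[X,Y]-R[RX,Y]-R[X,RY]$$ denote its Nijenhuis tensor, and call $R$ $\kappa$-calibrated if $g:=\kappa(R\,\cdot,\cdot)$ is a Riemannian metric on $M$ whose volume form (for the orientation of $M$ given by $\kappa^n$) is $d\mu(g)=\kappa^n/n!$. A Kähler structure on $M$ is a pair $(g,J)$ consisting of a Riemannian metric $g$ and $J\in \mathrm{End}(TM)$ with $J^2=-\mathbf I$, $g(J\,\cdot,J\,\cdot)=g$, $N_J\equiv 0$ and $d\big(g(J\,\cdot,\cdot)\big)=0$. Then the following statements are equivalent: 1. $M$ admits a Kähler structure $(g,J)$ such that $\kappa(\cdot,\cdot)=g(J\,\cdot,\cdot)$; 2. there exists a $\kappa$-calibrated $R\in \mathrm{End}(TM)$ such that $N_R\equiv 0$. -/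

import Mathlib

open scoped Manifold ContDiff

noncomputable section

namespace SymplecticManifold

section Linear

variable {V : Type*}

/-- The value `(β ∧ ⋯ ∧ β)(v₁, …, v₂ₙ)` (with `n` factors) of the `n`-th exterior power of an
alternating bilinear form `β`, with the usual normalisation
`(α ∧ γ)(v) = 1 / (p! q!) * ∑ σ, sign σ * α(v_σ(1), …, v_σ(p)) * γ(v_σ(p+1), …, v_σ(p+q))`
of the exterior product; thus `β ^ n (v) = 2⁻ⁿ * ∑ σ, sign σ * ∏ i, β(v_σ(2i), v_σ(2i+1))`. -/
def extPower (β : V → V → ℝ) (n : ℕ) (v : Fin (2 * n) → V) : ℝ :=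
  (2 ^ n : ℝ)⁻¹ * ∑ σ : Equiv.Perm (Fin (2 * n)), ((Equiv.Perm.sign σ : ℤ) : ℝ) *
    ∏ i : Fin n, β (v (σ ⟨2 * i, by omega⟩)) (v (σ ⟨2 * i + 1, by omega⟩))

/-- The Riemannian volume form of the inner product `g`, for the orientation in which a basis `v`
is positive when the top-degree form `o` is positive on `v`: on `(v₁, …, v_d)` it is
`± √ det (g(vᵢ, vⱼ))`, the sign being that of `o(v₁, …, v_d)`. -/
def volumeForm {d : ℕ} (g : V → V → ℝ) (o : (Fin d → V) → ℝ) (v : Fin d → V) : ℝ :=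
  (SignType.sign (o v) : ℝ) * Real.sqrt (Matrix.of fun i j => g (v i) (v j)).det

end Linear

section Manifold

variable (d : ℕ) (M : Type*) [TopologicalSpace M] [ChartedSpace (EuclideanSpace ℝ (Fin d)) M]
  [IsManifold (𝓡 d) ∞ M]

/-- Smooth vector fields on `M`. -/
abbrev VField : Type _ :=
  ContMDiffSection (𝓡 d) (EuclideanSpace ℝ (Fin d)) ∞
    (fun x : M => TangentSpace (𝓡 d) x)

/-- Smooth fields of endomorphisms of the tangent spaces, the elements of `End(TM)`. -/
abbrev EndField : Type _ :=
  ContMDiffSection (𝓡 d) (EuclideanSpace ℝ (Fin d) →L[ℝ] EuclideanSpace ℝ (Fin d)) ∞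
    (fun x : M => TangentSpace (𝓡 d) x →L[ℝ] TangentSpace (𝓡 d) x)

/-- Smooth fields of bilinear forms on the tangent spaces. -/
abbrev BilinField : Type _ :=
  ContMDiffSection (𝓡 d) (EuclideanSpace ℝ (Fin d) →L[ℝ] EuclideanSpace ℝ (Fin d) →L[ℝ] ℝ) ∞
    (fun x : M => TangentSpace (𝓡 d) x →L[ℝ] TangentSpace (𝓡 d) x →L[ℝ] ℝ)

/-- Smooth Riemannian metrics on `M`. -/
abbrev RMetric : Type _ :=
  Bundle.ContMDiffRiemannianMetric (𝓡 d) ∞ (EuclideanSpace ℝ (Fin d))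
    (fun x : M => TangentSpace (𝓡 d) x)

variable {d M}

/-- The Nijenhuis tensor `N_S(X, Y) = [SX, SY] + S²[X, Y] - S[SX, Y] - S[X, SY]`. -/
def nijenhuis (S : EndField d M) (X Y : VField d M) (x : M) : TangentSpace (𝓡 d) x :=
  VectorField.mlieBracket (𝓡 d) (fun y => S y (X y)) (fun y => S y (Y y)) x
    + S x (S x (VectorField.mlieBracket (𝓡 d) X Y x))
    - S x (VectorField.mlieBracket (𝓡 d) (fun y => S y (X y)) Y x)
    - S x (VectorField.mlieBracket (𝓡 d) X (fun y => S y (Y y)) x)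

/-- `N_S ≡ 0`. -/
def NijenhuisVanishes (S : EndField d M) : Prop :=
  ∀ (X Y : VField d M) (x : M), nijenhuis S X Y x = 0

/-- The derivative `(X f)(x) = df(X)(x)` of a function along a vector field. -/
def dirDeriv (X : VField d M) (f : M → ℝ) (x : M) : ℝ :=
  mfderiv (𝓡 d) 𝓘(ℝ, ℝ) f x (X x)

/-- The exterior derivative of a `2`-form:
`dβ(X, Y, Z) = X β(Y, Z) + Y β(Z, X) + Z β(X, Y) - β([X, Y], Z) - β([Y, Z], X) - β([Z, X], Y)`. -/
def extDerivTwo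
    (β : (x : M) → TangentSpace (𝓡 d) x →L[ℝ] TangentSpace (𝓡 d) x →L[ℝ] ℝ)
    (X Y Z : VField d M) (x : M) : ℝ :=
  dirDeriv X (fun y => β y (Y y) (Z y)) x
    + dirDeriv Y (fun y => β y (Z y) (X y)) x
    + dirDeriv Z (fun y => β y (X y) (Y y)) x
    - β x (VectorField.mlieBracket (𝓡 d) X Y x) (Z x)
    - β x (VectorField.mlieBracket (𝓡 d) Y Z x) (X x)
    - β x (VectorField.mlieBracket (𝓡 d) Z X x) (Y x)

/-- `κ` is a symplectic form: a closed, nondegenerate smooth `2`-form. -/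
structure IsSymplectic (κ : BilinField d M) : Prop where
  alternating : ∀ (x : M) (u : TangentSpace (𝓡 d) x), κ x u u = 0
  nondegenerate : ∀ (x : M) (u : TangentSpace (𝓡 d) x), (∀ w, κ x u w = 0) → u = 0
  closed : ∀ (X Y Z : VField d M) (x : M), extDerivTwo κ X Y Z x = 0

/-- The fundamental form `g(J·, ·)`. -/
def fundamentalForm (g : RMetric d M) (J : EndField d M) (x : M) :
    TangentSpace (𝓡 d) x →L[ℝ] TangentSpace (𝓡 d) x →L[ℝ] ℝ :=
  (g.inner x).comp (J x)

/-- `(g, J)` is a Kähler structure on `M`: `J` is an almost complex structure with vanishing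
Nijenhuis tensor, `g` is a `J`-Hermitian Riemannian metric, and `g(J·, ·)` is closed. -/
structure IsKahler (g : RMetric d M) (J : EndField d M) : Prop where
  sq_eq_neg : ∀ (x : M) (u : TangentSpace (𝓡 d) x), J x (J x u) = -u
  hermitian : ∀ (x : M) (u w : TangentSpace (𝓡 d) x),
    g.inner x (J x u) (J x w) = g.inner x u w
  integrable : NijenhuisVanishes J
  closed : ∀ (X Y Z : VField d M) (x : M), extDerivTwo (fundamentalForm g J) X Y Z x = 0

/-- `R` is `κ`-calibrated: `g = κ(R·, ·)` is a Riemannian metric whose volume form, for the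
orientation given by `κⁿ`, is `κⁿ / n!`. -/
def IsCalibrated {n : ℕ} {M : Type*} [TopologicalSpace M]
    [ChartedSpace (EuclideanSpace ℝ (Fin (2 * n))) M] [IsManifold (𝓡 (2 * n)) ∞ M]
    (κ : BilinField (2 * n) M) (R : EndField (2 * n) M) : Prop :=
  ∃ g : RMetric (2 * n) M,
    (∀ (x : M) (u w : TangentSpace (𝓡 (2 * n)) x), g.inner x u w = κ x (R x u) w) ∧
    ∀ (x : M) (v : Fin (2 * n) → TangentSpace (𝓡 (2 * n)) x),
      volumeForm (fun u w => g.inner x u w) (extPower (fun u w => κ x u w) n) v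
        = extPower (fun u w => κ x u w) n v / (n.factorial : ℝ)

end Manifold

end SymplecticManifold

end

/-! Given a Kähler structure, `R = -J` works: `κ(-J·, ·) = g`, and the volume identity
`volumeForm_eq_extPower_div` is checked on a basis `e₁, Je₁, …, eₙ, Jeₙ` that is orthonormal and
symplectic at once.

Conversely, let `g = κ(R·, ·)` and `N_R = 0`. Then `R` is invertible and `g`-skew, so `S = -R²` is
symmetric and positive, and one wants to normalise `R` to `R S^(-1/2)`. This keeps the Nijenhuis
tensor zero if it is a polynomial in `R` with constant coefficients (`torsion_aeval`), which
requires eigenvalues of `S` independent of the point.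

The constancy comes from traces. In a chart, `N_R = 0` implies `tr(R^k D_{Rv}R) = tr(R^(k+1) D_v R)`
(`trace_pow_mul_of_torsion_free`). Odd powers of a skew `R` are traceless, so differentiating gives
`tr(R^(2m+2) D_v R) = 0`; by the identity and surjectivity of `R`, `tr(R^(2m+1) D_v R) = 0`, so `tr
R^(2m+2)` has zero derivative and is constant on the connected `M` (`clmTrace_modelEnd_pow_eq`).

A polynomial with simple positive roots that kills `S` at one point therefore kills it everywhere.
Choosing `r` with `l * r(l)⁴ = 1` at these roots, `Q = R r(S)²` satisfies `Q² = -1` and `κ(Q·, ·) =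
g(r(S)·, r(S)·)`. The Kähler structure is `J = -Q` with the metric `κ(Q·, ·)`; its fundamental form
is `κ`. -/

noncomputable section

namespace SymplecticManifold

/-! ### Nijenhuis torsion of polynomials in an endomorphism. -/

section TorsionAlgebra

open Polynomial

variable {V : Type*} [AddCommGroup V] [Module ℝ V]

/-- The mixed Nijenhuis torsion of two endomorphisms `a`, `b` with respect to a bilinear
bracket `L`. -/
def torsion (L : V →ₗ[ℝ] V →ₗ[ℝ] V) (a b : Module.End ℝ V) (X Y : V) : V :=
  L (a X) (b Y) - a (L X (b Y)) - b (L (a X) Y) + a (b (L X Y))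

variable {L : V →ₗ[ℝ] V →ₗ[ℝ] V}

/-- A Leibniz rule: with its counterpart in the other slot it reduces the torsion of powers to that
of the factors. -/
lemma torsion_mul_left {a a' b : Module.End ℝ V} (h : Commute a b) (X Y : V) :
    torsion L (a * a') b X Y = torsion L a b (a' X) Y + a (torsion L a' b X Y) := by
  have h' : ∀ Z, a (b Z) = b (a Z) := fun Z => LinearMap.congr_fun h.eq Z
  simp only [torsion, Module.End.mul_apply, map_add, map_sub, h']
  abel

lemma torsion_mul_right {a b b' : Module.End ℝ V} (h : Commute a b) (X Y : V) :
    torsion L a (b * b') X Y = torsion L a b X (b' Y) + b (torsion L a b' X Y) := by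
  have h' : ∀ Z, a (b Z) = b (a Z) := fun Z => LinearMap.congr_fun h.eq Z
  simp only [torsion, Module.End.mul_apply, map_add, map_sub, h']
  abel

lemma torsion_add_left (a a' b : Module.End ℝ V) (X Y : V) :
    torsion L (a + a') b X Y = torsion L a b X Y + torsion L a' b X Y := by
  simp only [torsion, LinearMap.add_apply, map_add]
  abel

lemma torsion_add_right (a b b' : Module.End ℝ V) (X Y : V) :
    torsion L a (b + b') X Y = torsion L a b X Y + torsion L a b' X Y := by
  simp only [torsion, LinearMap.add_apply, map_add]
  abel

lemma torsion_algebraMap_left (c : ℝ) (b : Module.End ℝ V) (X Y : V) :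
    torsion L (algebraMap ℝ (Module.End ℝ V) c) b X Y = 0 := by
  simp [torsion, Module.algebraMap_end_apply]

lemma torsion_algebraMap_right (c : ℝ) (a : Module.End ℝ V) (X Y : V) :
    torsion L a (algebraMap ℝ (Module.End ℝ V) c) X Y = 0 := by
  simp [torsion, Module.algebraMap_end_apply]

lemma torsion_aeval_left {a b : Module.End ℝ V} (hab : Commute a b)
    (h : ∀ X Y, torsion L a b X Y = 0) (p : ℝ[X]) (X Y : V) :
    torsion L (aeval a p) b X Y = 0 := by
  induction p using Polynomial.induction_on' generalizing X Y with
  | add p q hp hq => rw [map_add, torsion_add_left, hp, hq, add_zero]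
  | monomial n c =>
    -- With the scalar on the right, peeling factors off the left ends at a scalar endomorphism,
    -- which has no torsion.
    rw [aeval_monomial, Algebra.commutes]
    induction n with
    | zero => rw [pow_zero, one_mul, torsion_algebraMap_left]
    | succ n ih =>
      rw [pow_succ', mul_assoc, torsion_mul_left hab, ih, h, map_zero, add_zero]

lemma torsion_aeval_right {a b : Module.End ℝ V} (hab : Commute a b)
    (h : ∀ X Y, torsion L a b X Y = 0) (p : ℝ[X]) (X Y : V) :
    torsion L a (aeval b p) X Y = 0 := by
  induction p using Polynomial.induction_on' generalizing X Y with
  | add p q hp hq => rw [map_add, torsion_add_right, hp, hq, add_zero]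
  | monomial n c =>
    rw [aeval_monomial, Algebra.commutes]
    induction n with
    | zero => rw [pow_zero, one_mul, torsion_algebraMap_right]
    | succ n ih =>
      rw [pow_succ', mul_assoc, torsion_mul_right hab, ih, h, map_zero, add_zero]

/-- If `a` has vanishing Nijenhuis torsion, so has every polynomial in `a`. -/
lemma torsion_aeval {a : Module.End ℝ V} (h : ∀ X Y, torsion L a a X Y = 0) (p : ℝ[X]) (X Y : V) :
    torsion L (aeval a p) (aeval a p) X Y = 0 :=
  torsion_aeval_right (by simpa using (Commute.all p Polynomial.X).map (aeval a))
    (torsion_aeval_left (Commute.refl a) h p) p X Y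

end TorsionAlgebra

/-! ### Trace identities for torsion-free and for skew endomorphisms. -/

section Traces

variable {V : Type*} [AddCommGroup V] [Module ℝ V]

/-- The trace identity behind the constancy of the eigenvalues of a torsion-free endomorphism
field: `a` is the value and `D` the derivative of the field at a point. -/
lemma trace_pow_mul_of_torsion_free {a : Module.End ℝ V} {D : V →ₗ[ℝ] Module.End ℝ V}
    (h : ∀ v w, D (a v) w - D (a w) v - a (D v w) + a (D w v) = 0) (k : ℕ) (v : V) :
    LinearMap.trace ℝ V (a ^ k * D (a v)) = LinearMap.trace ℝ V (a ^ (k + 1) * D v) := by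
  -- The hypothesis as an identity of endomorphisms in `w`, where `D.flip v` is `w ↦ D w v`. By
  -- cyclicity the two terms with `D.flip v` have equal traces and cancel.
  have key : a ^ k * D (a v) - a ^ k * (D.flip v * a) - a ^ (k + 1) * D v
      + a ^ (k + 1) * D.flip v = 0 := by
    ext w
    have := congrArg (a ^ k) (h v w)
    simpa [pow_succ, Module.End.mul_apply] using this
  have h1 := congrArg (LinearMap.trace ℝ V) key
  have h2 : LinearMap.trace ℝ V (a ^ k * (D.flip v * a))
      = LinearMap.trace ℝ V (a ^ (k + 1) * D.flip v) := by
    rw [← mul_assoc, LinearMap.trace_mul_comm, ← mul_assoc, pow_succ']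
  simp only [map_add, map_sub, map_zero] at h1
  linarith

/-- A skew endomorphism has odd powers of trace zero. -/
lemma trace_pow_eq_zero_of_skew [FiniteDimensional ℝ V] {g : V →ₗ[ℝ] V →ₗ[ℝ] ℝ}
    (hg : ∀ v, v ≠ 0 → 0 < g v v) {a : Module.End ℝ V} (ha : ∀ v w, g (a v) w = - g v (a w))
    {k : ℕ} (hk : Odd k) :
    LinearMap.trace ℝ V (a ^ k) = 0 := by
  have hpow : ∀ k v w, g ((a ^ k) v) w = (-1) ^ k * g v ((a ^ k) w) := by
    intro k
    induction k with
    | zero => simp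
    | succ k ih =>
      intro v w
      rw [pow_succ, Module.End.mul_apply, ih, ha, ← Module.End.mul_apply a (a ^ k), ← pow_succ',
        pow_succ]
      ring
  have hinj : Function.Injective g := by
    rw [← LinearMap.ker_eq_bot, LinearMap.ker_eq_bot']
    intro v hv
    by_contra h0
    exact (hg v h0).ne' (by simp [hv])
  let e : V ≃ₗ[ℝ] Module.Dual ℝ V :=
    LinearEquiv.ofInjectiveOfFinrankEq g hinj (Subspace.dual_finrank_eq).symm
  have he : ∀ v, e v = g v := fun v => rfl
  -- The isomorphism of `V` with its dual given by `g` turns `a ^ k` into minus its transpose, so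
  -- the trace equals its own negative.
  have hconj : e.conj (a ^ k) = - Module.Dual.transpose (R := ℝ) (a ^ k) := by
    ext f w
    obtain ⟨v, rfl⟩ := e.surjective f
    have hv : e.symm (g v) = v := by rw [← he, e.symm_apply_apply]
    simp [LinearEquiv.conj_apply, he, hv, hpow, hk.neg_one_pow, Module.Dual.transpose_apply]
  have h1 := LinearMap.trace_conj' (a ^ k) e
  rw [hconj, map_neg (LinearMap.trace ℝ (Module.Dual ℝ V)), LinearMap.trace_transpose'] at h1
  linarith

end Traces

/-! ### Spectral theory of symmetric endomorphisms; interpolation. -/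

section Spectral

open Polynomial

variable {V : Type*} [AddCommGroup V] [Module ℝ V] [FiniteDimensional ℝ V]

/-- The inner product space core of a positive definite symmetric bilinear form. -/
@[reducible]
def innerCore (g : V →ₗ[ℝ] V →ₗ[ℝ] ℝ) (hs : ∀ v w, g v w = g w v)
    (hg : ∀ v, v ≠ 0 → 0 < g v v) : InnerProductSpace.Core ℝ V where
  inner v w := g v w
  conj_inner_symm v w := by simp [hs v w]
  re_inner_nonneg v := by
    by_cases h : v = 0
    · simp [h]
    · simpa using (hg v h).le
  add_left u v w := by simp
  smul_left u v c := by simp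
  definite v hv := by
    by_contra h
    exact (hg v h).ne' hv

/-- A symmetric endomorphism whose square is traceless vanishes. -/
lemma eq_zero_of_trace_sq_eq_zero {g : V →ₗ[ℝ] V →ₗ[ℝ] ℝ} (hs : ∀ v w, g v w = g w v)
    (hg : ∀ v, v ≠ 0 → 0 < g v v) {T : Module.End ℝ V} (hT : ∀ v w, g (T v) w = g v (T w))
    (h : LinearMap.trace ℝ V (T * T) = 0) : T = 0 := by
  let c := innerCore g hs hg
  let : NormedAddCommGroup V := c.toNormedAddCommGroup
  let : InnerProductSpace ℝ V := InnerProductSpace.ofCore c.toCore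
  have hT' : ∀ v w : V, inner ℝ (T v) w = inner ℝ v (T w) := hT
  rw [LinearMap.trace_eq_sum_inner (T * T) (stdOrthonormalBasis ℝ V)] at h
  -- The trace of `T * T` is thus a sum of squared norms over an orthonormal basis.
  have hn : ∀ v : V, inner ℝ v ((T * T) v) = ‖T v‖ ^ 2 := fun v => by
    rw [Module.End.mul_apply, ← hT', real_inner_self_eq_norm_sq]
  simp only [hn] at h
  rw [Finset.sum_eq_zero_iff_of_nonneg (fun i _ => by positivity)] at h
  refine (stdOrthonormalBasis ℝ V).toBasis.ext fun i => ?_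
  simpa using h i (Finset.mem_univ i)

/-- A symmetric positive endomorphism is annihilated by a polynomial with simple positive roots. -/
lemma exists_finset_aeval_prod_eq_zero {g : V →ₗ[ℝ] V →ₗ[ℝ] ℝ} (hs : ∀ v w, g v w = g w v)
    (hg : ∀ v, v ≠ 0 → 0 < g v v) {S : Module.End ℝ V} (hS : ∀ v w, g (S v) w = g v (S w))
    (hpos : ∀ v, v ≠ 0 → 0 < g (S v) v) :
    ∃ Λ : Finset ℝ, (∀ l ∈ Λ, 0 < l) ∧ aeval S (∏ l ∈ Λ, (X - C l)) = 0 := by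
  let c := innerCore g hs hg
  let : NormedAddCommGroup V := c.toNormedAddCommGroup
  let : InnerProductSpace ℝ V := InnerProductSpace.ofCore c.toCore
  have hS' : S.IsSymmetric := hS
  let b := hS'.eigenvectorBasis rfl
  have hb : ∀ i, S (b i) = hS'.eigenvalues rfl i • b i := fun i =>
    hS'.apply_eigenvectorBasis rfl i
  refine ⟨Finset.univ.image (hS'.eigenvalues rfl), ?_, ?_⟩
  · simp only [Finset.mem_image, Finset.mem_univ, true_and, forall_exists_index,
      forall_apply_eq_imp_iff]
    intro i
    have h1 := hpos (b i) (b.orthonormal.ne_zero i)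
    have h2 := hg (b i) (b.orthonormal.ne_zero i)
    rw [hb, map_smul, LinearMap.smul_apply, smul_eq_mul] at h1
    exact pos_of_mul_pos_left h1 h2.le
  · refine b.toBasis.ext fun i => ?_
    -- The factor of the eigenvalue of `b i` is made to act first; it kills `b i`.
    rw [← Finset.mul_prod_erase _ _ (Finset.mem_image_of_mem _ (Finset.mem_univ i)), mul_comm]
    simp [hb]

/-- A real polynomial `r` with `l * r(l)⁴ = 1` for the finitely many given `l > 0`. -/
lemma exists_polynomial_dvd (Λ : Finset ℝ) (hΛ : ∀ l ∈ Λ, 0 < l) :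
    ∃ r : ℝ[X], (∏ l ∈ Λ, (X - C l)) ∣ X * r ^ 4 - 1 := by
  -- Interpolating `l^(-1/4)` rather than `l^(-1/2)` makes the correction factor a square `r(S)²`,
  -- from which positivity of the new metric is immediate.
  let f : ℝ → ℝ := fun l => (Real.sqrt (Real.sqrt l))⁻¹
  refine ⟨Lagrange.interpolate Λ id f, ?_⟩
  refine Finset.prod_dvd_of_coprime ?_ fun l hl => ?_
  · intro a _ b _ hab
    exact pairwise_coprime_X_sub_C Function.injective_id hab
  · rw [dvd_iff_isRoot, IsRoot.def]
    have h1 : eval l (Lagrange.interpolate Λ id f) = f l :=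
      Lagrange.eval_interpolate_at_node f (Set.injOn_id _) hl
    have hl0 := hΛ l hl
    have h4 : Real.sqrt (Real.sqrt l) ^ 4 = l := by
      rw [show 4 = 2 * 2 from rfl, pow_mul, Real.sq_sqrt (Real.sqrt_nonneg _),
        Real.sq_sqrt hl0.le]
    simp only [eval_sub, eval_mul, eval_X, eval_pow, eval_one, h1, f, inv_pow, h4]
    field_simp
    simp

end Spectral

/-! ### The volume form of a Hermitian vector space. -/

section Volume

variable {V : Type*} [AddCommGroup V] [Module ℝ V]

lemma exists_eq_pair {n : ℕ} (j : Fin (2 * n)) :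
    ∃ i : Fin n, j = ⟨2 * i, by omega⟩ ∨ j = ⟨2 * i + 1, by omega⟩ := by
  refine ⟨⟨j / 2, by omega⟩, ?_⟩
  simp only [Fin.ext_iff]
  omega

/-- On updating one vector, the product over the pairs changes in one factor only. -/
lemma prod_pair_update (β : V →ₗ[ℝ] V →ₗ[ℝ] ℝ) {n : ℕ} (v : Fin (2 * n) → V) (j : Fin (2 * n)) :
    ∃ f : V →ₗ[ℝ] ℝ, ∀ x, ∏ i : Fin n, β (Function.update v j x ⟨2 * i, by omega⟩)
      (Function.update v j x ⟨2 * i + 1, by omega⟩) = f x := by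
  obtain ⟨k, hk⟩ := exists_eq_pair j
  let c : ℝ := ∏ i ∈ Finset.univ.erase k, β (v ⟨2 * i, by omega⟩) (v ⟨2 * i + 1, by omega⟩)
  have hc : ∀ x, ∏ i ∈ Finset.univ.erase k, β (Function.update v j x ⟨2 * i, by omega⟩)
      (Function.update v j x ⟨2 * i + 1, by omega⟩) = c := fun x => by
    refine Finset.prod_congr rfl fun i hi => ?_
    have hik : i.1 ≠ k.1 := fun h => (Finset.mem_erase.1 hi).1 (Fin.ext h)
    rw [Function.update_of_ne, Function.update_of_ne]
    all_goals
      rcases hk with rfl | rfl <;> simp only [ne_eq, Fin.ext_iff] <;> omega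
  rcases hk with rfl | rfl
  · refine ⟨c • β.flip (v ⟨2 * k + 1, by omega⟩), fun x => ?_⟩
    rw [← Finset.mul_prod_erase _ _ (Finset.mem_univ k), hc, Function.update_self,
      Function.update_of_ne (by simp), mul_comm]
    simp
  · refine ⟨c • β (v ⟨2 * k, by omega⟩), fun x => ?_⟩
    rw [← Finset.mul_prod_erase _ _ (Finset.mem_univ k), hc, Function.update_self,
      Function.update_of_ne (by simp), mul_comm]
    simp

/-- The multilinear map `v ↦ ∏ i, β(v₂ᵢ, v₂ᵢ₊₁)`. -/
def pairProd (β : V →ₗ[ℝ] V →ₗ[ℝ] ℝ) (n : ℕ) :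
    MultilinearMap ℝ (fun _ : Fin (2 * n) => V) ℝ :=
  MultilinearMap.mk' (fun v => ∏ i : Fin n, β (v ⟨2 * i, by omega⟩) (v ⟨2 * i + 1, by omega⟩))
    (fun v j x y => by
      obtain ⟨f, hf⟩ := prod_pair_update β v j
      rw [hf, hf, hf, map_add])
    (fun v j c x => by
      obtain ⟨f, hf⟩ := prod_pair_update β v j
      rw [hf, hf, map_smul])

/-- The `n`-th exterior power of a bilinear form, as an alternating map. -/
def extPowerAlt (β : V →ₗ[ℝ] V →ₗ[ℝ] ℝ) (n : ℕ) : V [⋀^Fin (2 * n)]→ₗ[ℝ] ℝ :=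
  (2 ^ n : ℝ)⁻¹ • MultilinearMap.alternatization (pairProd β n)

lemma extPowerAlt_apply (β : V →ₗ[ℝ] V →ₗ[ℝ] ℝ) (n : ℕ) (v : Fin (2 * n) → V) :
    extPowerAlt β n v = extPower (fun u w => β u w) n v := by
  simp [extPowerAlt, extPower, MultilinearMap.alternatization_apply, pairProd,
    Units.smul_def]

/-- `(i, 0) ↦ 2i`, `(i, 1) ↦ 2i + 1`. -/
def pairEquiv (n : ℕ) : Fin n × Fin 2 ≃ Fin (2 * n) :=
  finProdFinEquiv.trans (finCongr (mul_comm n 2))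

lemma pairEquiv_zero {n : ℕ} (i : Fin n) : pairEquiv n (i, 0) = ⟨2 * i, by omega⟩ := by
  ext; simp [pairEquiv]

lemma pairEquiv_one {n : ℕ} (i : Fin n) : pairEquiv n (i, 1) = ⟨2 * i + 1, by omega⟩ := by
  ext; simp [pairEquiv]; omega

/-- The standard symplectic form on `Fin n × Fin 2`. -/
def stdForm {n : ℕ} (p q : Fin n × Fin 2) : ℝ :=
  if p.1 = q.1 then (if p.2 = q.2 then 0 else if p.2 = 0 then 1 else -1) else 0

/-- The permutation of `Fin n × Fin 2` permuting the blocks by `τ` after applying `ε i` to the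
`i`-th block. -/
def blockPerm {n : ℕ} (p : Equiv.Perm (Fin n) × (Fin n → Equiv.Perm (Fin 2))) :
    Equiv.Perm (Fin n × Fin 2) :=
  Equiv.prodCongrLeft (fun _ => p.1) * Equiv.prodCongrRight p.2

lemma blockPerm_apply {n : ℕ} (p : Equiv.Perm (Fin n) × (Fin n → Equiv.Perm (Fin 2)))
    (x : Fin n × Fin 2) : blockPerm p x = (p.1 x.1, p.2 x.1 x.2) := by
  rw [blockPerm, Equiv.Perm.mul_apply]
  rfl

/-- Permuting whole blocks of size two is even, so only the swaps within blocks count. -/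
lemma sign_blockPerm {n : ℕ} (p : Equiv.Perm (Fin n) × (Fin n → Equiv.Perm (Fin 2))) :
    Equiv.Perm.sign (blockPerm p) = ∏ i, Equiv.Perm.sign (p.2 i) := by
  rw [blockPerm, map_mul, Equiv.Perm.sign_prodCongrLeft, Equiv.Perm.sign_prodCongrRight]
  simp

lemma stdForm_blockPerm {n : ℕ} (p : Equiv.Perm (Fin n) × (Fin n → Equiv.Perm (Fin 2)))
    (i : Fin n) :
    stdForm (blockPerm p (i, 0)) (blockPerm p (i, 1)) = ((Equiv.Perm.sign (p.2 i) : ℤ) : ℝ) := by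
  have h : ∀ ε : Equiv.Perm (Fin 2), stdForm (p.1 i, ε 0) (p.1 i, ε 1)
      = ((Equiv.Perm.sign ε : ℤ) : ℝ) := by
    intro ε
    have : ε = 1 ∨ ε = Equiv.swap 0 1 := by revert ε; decide
    rcases this with rfl | rfl <;> simp [stdForm]
  simpa [blockPerm_apply] using h (p.2 i)

lemma blockPerm_injective (n : ℕ) : Function.Injective (blockPerm (n := n)) := by
  intro p q h
  have h' : ∀ x, blockPerm p x = blockPerm q x := fun x => by rw [h]
  simp only [blockPerm_apply, Prod.forall, Prod.mk.injEq] at h'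
  exact Prod.ext (Equiv.ext fun i => (h' i 0).1) (funext fun i => Equiv.ext fun j => (h' i j).2)

/-- Nonvanishing factors force `σ` to carry each pair onto a pair: first coordinates give the
permutation of the blocks, second coordinates those inside them. -/
lemma exists_blockPerm_eq {n : ℕ} {σ : Equiv.Perm (Fin n × Fin 2)}
    (h : ∀ i, stdForm (σ (i, 0)) (σ (i, 1)) ≠ 0) : ∃ p, blockPerm p = σ := by
  have h1 : ∀ i, (σ (i, 0)).1 = (σ (i, 1)).1 ∧ (σ (i, 0)).2 ≠ (σ (i, 1)).2 := fun i => by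
    have := h i
    simp only [stdForm] at this
    split_ifs at this with h1 h2
    all_goals simp_all
  have hfst : ∀ i j, (σ (i, j)).1 = (σ (i, 0)).1 := fun i j => by
    fin_cases j
    · rfl
    · exact (h1 i).1.symm
  have hτ : Function.Bijective fun i => (σ (i, 0)).1 := by
    rw [← Finite.surjective_iff_bijective]
    intro k
    obtain ⟨⟨i, j⟩, hij⟩ := σ.surjective (k, 0)
    exact ⟨i, by simp only [← hfst i j, hij]⟩
  have hε : ∀ i, Function.Bijective fun j => (σ (i, j)).2 := fun i => by
    rw [← Finite.injective_iff_bijective]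
    intro j k hjk
    have : σ (i, j) = σ (i, k) := Prod.ext ((hfst i j).trans (hfst i k).symm) hjk
    exact (Prod.ext_iff.1 (σ.injective this)).2
  refine ⟨(Equiv.ofBijective _ hτ, fun i => Equiv.ofBijective _ (hε i)), Equiv.ext fun x => ?_⟩
  rw [blockPerm_apply]
  exact Prod.ext (hfst x.1 x.2).symm rfl

/-- Only block permutations contribute, each of them `1` because its sign cancels against the
product of forms; there are `2 ^ n * n!` of them. -/
lemma sum_sign_mul_prod_stdForm (n : ℕ) :
    ∑ σ : Equiv.Perm (Fin n × Fin 2), ((Equiv.Perm.sign σ : ℤ) : ℝ) *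
      ∏ i : Fin n, stdForm (σ (i, 0)) (σ (i, 1)) = 2 ^ n * n.factorial := by
  classical
  rw [← Finset.sum_subset (Finset.subset_univ (Finset.univ.image (blockPerm (n := n)))),
    Finset.sum_image (blockPerm_injective n).injOn]
  · have h1 : ∀ p : Equiv.Perm (Fin n) × (Fin n → Equiv.Perm (Fin 2)),
        ((Equiv.Perm.sign (blockPerm p) : ℤ) : ℝ) *
          ∏ i : Fin n, stdForm (blockPerm p (i, 0)) (blockPerm p (i, 1)) = 1 := fun p => by
      simp only [stdForm_blockPerm, sign_blockPerm, Units.coe_prod, Int.cast_prod,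
        ← Finset.prod_mul_distrib]
      refine Finset.prod_eq_one fun i _ => ?_
      rcases Int.units_eq_one_or (Equiv.Perm.sign (p.2 i)) with h | h <;> simp [h]
    simp [h1, Fintype.card_perm, mul_comm]
  · intro σ _ hσ
    by_contra h
    refine hσ ?_
    obtain ⟨p, hp⟩ := exists_blockPerm_eq (σ := σ) fun i hi =>
      h (by rw [Finset.prod_eq_zero (Finset.mem_univ i) hi, mul_zero])
    exact Finset.mem_image.2 ⟨p, Finset.mem_univ _, hp⟩

lemma extPower_of_stdForm {V : Type*} {β : V → V → ℝ} {n : ℕ} {v : Fin (2 * n) → V}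
    (h : ∀ p q, β (v (pairEquiv n p)) (v (pairEquiv n q)) = stdForm p q) :
    extPower β n v = n.factorial := by
  have h1 := sum_sign_mul_prod_stdForm n
  rw [← (pairEquiv n).permCongr.symm.sum_comp] at h1
  rw [extPower, eq_comm, eq_inv_mul_iff_mul_eq₀ (by positivity), ← h1]
  refine Finset.sum_congr rfl fun σ _ => ?_
  congr 1
  · simp [Equiv.permCongr]
  · refine Finset.prod_congr rfl fun i _ => ?_
    rw [← h, ← pairEquiv_zero, ← pairEquiv_one]
    simp [Equiv.permCongr]

/-- A Hermitian vector space has unitary families of any length up to its complex dimension. -/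
lemma exists_unitary_family [FiniteDimensional ℝ V] {g : V →ₗ[ℝ] V →ₗ[ℝ] ℝ}
    (hs : ∀ v w, g v w = g w v) (hg : ∀ v, v ≠ 0 → 0 < g v v) {J : Module.End ℝ V}
    (hJ : ∀ v, J (J v) = -v) (hgJ : ∀ v w, g (J v) (J w) = g v w) (k : ℕ)
    (hk : 2 * k ≤ Module.finrank ℝ V) :
    ∃ e : Fin k → V, (∀ i j, g (e i) (e j) = if i = j then 1 else 0) ∧
      ∀ i j, g (J (e i)) (e j) = 0 := by
  have hskew : ∀ v w, g (J v) w = - g (J w) v := fun v w => by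
    rw [← hgJ (J v) w, hJ, map_neg, LinearMap.neg_apply, hs v]
  induction k with
  | zero => exact ⟨Fin.elim0, fun i => i.elim0, fun i => i.elim0⟩
  | succ k ih =>
    obtain ⟨e, h1, h2⟩ := ih (by omega)
    -- Orthogonality to all `e i` and `J (e i)` is `2k` equations in dimension at least `2k + 2`.
    let f : V →ₗ[ℝ] (Fin k → ℝ) × (Fin k → ℝ) :=
      (LinearMap.pi fun i => g (e i)).prod (LinearMap.pi fun i => g (J (e i)))
    obtain ⟨u, hu, hu0⟩ := Submodule.exists_mem_ne_zero_of_ne_bot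
      (LinearMap.ker_ne_bot_of_finrank_lt (f := f) (by simp; omega))
    have hu1 : ∀ i, g (e i) u = 0 ∧ g (J (e i)) u = 0 := fun i => by
      have := Prod.ext_iff.1 (LinearMap.mem_ker.1 hu)
      exact ⟨congrFun this.1 i, congrFun this.2 i⟩
    have hpos := hg u hu0
    let c := (Real.sqrt (g u u))⁻¹
    have hc : c * (c * g u u) = 1 := by
      rw [← mul_assoc, ← sq, inv_pow, Real.sq_sqrt hpos.le, inv_mul_cancel₀ hpos.ne']
    refine ⟨Fin.snoc e (c • u), fun i j => ?_, fun i j => ?_⟩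
    · induction i using Fin.lastCases with
      | last =>
        induction j using Fin.lastCases with
        | last => simpa using hc
        | cast j => simp [hs u, hu1, (Fin.castSucc_lt_last j).ne']
      | cast i =>
        induction j using Fin.lastCases with
        | last => simp [hu1, (Fin.castSucc_lt_last i).ne]
        | cast j => simp [h1]
    · induction i using Fin.lastCases with
      | last =>
        induction j using Fin.lastCases with
        | last =>
          have := hskew u u
          have : g (J u) u = 0 := by linarith
          simp [this]
        | cast j => simp [hskew u, hu1]
      | cast i =>
        induction j using Fin.lastCases with
        | last => simp [hu1]
        | cast j => simp [h2]

/-- A Hermitian vector space of real dimension `2n` has a real orthonormal basis that is a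
symplectic basis of the fundamental form. -/
lemma exists_unitary_basis [FiniteDimensional ℝ V] {g : V →ₗ[ℝ] V →ₗ[ℝ] ℝ}
    (hs : ∀ v w, g v w = g w v) (hg : ∀ v, v ≠ 0 → 0 < g v v) {J : Module.End ℝ V}
    (hJ : ∀ v, J (J v) = -v) (hgJ : ∀ v w, g (J v) (J w) = g v w) {n : ℕ}
    (hn : Module.finrank ℝ V = 2 * n) :
    ∃ b : Module.Basis (Fin (2 * n)) ℝ V, (∀ i j, g (b i) (b j) = if i = j then 1 else 0) ∧
      ∀ p q, g (J (b (pairEquiv n p))) (b (pairEquiv n q)) = stdForm p q := by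
  obtain ⟨e, h1, h2⟩ := exists_unitary_family hs hg hJ hgJ n hn.ge
  have h2' : ∀ i j, g (e i) (J (e j)) = 0 := fun i j => by rw [hs, h2]
  let v : Fin n × Fin 2 → V := fun p => if p.2 = 0 then e p.1 else J (e p.1)
  have hv : ∀ p q, g (v p) (v q) = if p = q then 1 else 0 := by
    rintro ⟨i, a⟩ ⟨j, b⟩
    fin_cases a <;> fin_cases b <;> simp [v, h1, h2, h2', hgJ, Prod.ext_iff]
  have hvJ : ∀ p q, g (J (v p)) (v q) = stdForm p q := by
    rintro ⟨i, a⟩ ⟨j, b⟩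
    fin_cases a <;> fin_cases b <;> simp [v, h1, h2, h2', hgJ, hJ, stdForm]
    split_ifs <;> simp
  have hli : LinearIndependent ℝ fun i => v ((pairEquiv n).symm i) := by
    rw [Fintype.linearIndependent_iff]
    intro c hc i
    have := congrArg (g (v ((pairEquiv n).symm i))) hc
    simpa [hv] using this
  refine ⟨Module.Basis.mk hli (hli.span_eq_top_of_card_eq_finrank' (by simp [hn])).ge,
    fun i j => ?_,
    fun p q => ?_⟩
  · simp [hv]
  · simp [hvJ]

/-- The volume form of a Hermitian inner product is `ωⁿ / n!`, where `ω = g(J·, ·)`. -/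
theorem volumeForm_eq_extPower_div [FiniteDimensional ℝ V] {g : V →ₗ[ℝ] V →ₗ[ℝ] ℝ}
    (hs : ∀ v w, g v w = g w v) (hg : ∀ v, v ≠ 0 → 0 < g v v) {J : Module.End ℝ V}
    (hJ : ∀ v, J (J v) = -v) (hgJ : ∀ v w, g (J v) (J w) = g v w) {n : ℕ}
    (hn : Module.finrank ℝ V = 2 * n) (v : Fin (2 * n) → V) :
    volumeForm (fun u w => g u w) (extPower (fun u w => g (J u) w) n) v
      = extPower (fun u w => g (J u) w) n v / (n.factorial : ℝ) := by
  obtain ⟨b, h1, h2⟩ := exists_unitary_basis hs hg hJ hgJ hn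
  have hfac : (0 : ℝ) < n.factorial := by positivity
  have hext : extPower (fun u w => g (J u) w) n v = n.factorial * b.det v := by
    -- A top-degree alternating form is its value on a basis times the determinant, and on the
    -- unitary basis that value is `n!`.
    have h := AlternatingMap.eq_smul_basis_det b (extPowerAlt (g ∘ₗ J) n)
    have h' := congrArg (fun f => f v) h
    simp only [AlternatingMap.smul_apply, extPowerAlt_apply, LinearMap.comp_apply,
      smul_eq_mul] at h'
    rw [h', extPower_of_stdForm h2]
  have hdet : (Matrix.of fun i j => g (v i) (v j)).det = b.det v ^ 2 := by
    have : (Matrix.of fun i j => g (v i) (v j)) = (b.toMatrix v).transpose * b.toMatrix v := by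
      ext i j
      simp only [Matrix.of_apply, Matrix.mul_apply, Matrix.transpose_apply,
        Module.Basis.toMatrix_apply]
      rw [← LinearMap.sum_repr_mul_repr_mul b b]
      simp [h1, Finsupp.sum_fintype]
    rw [this, Matrix.det_mul, Matrix.det_transpose, Module.Basis.det_apply, sq]
  rw [volumeForm, hdet, hext, Real.sqrt_sq_eq_abs, sign_mul, sign_pos hfac, one_mul,
    mul_div_cancel_left₀ _ hfac.ne', sign_mul_abs]

end Volume

/-! ### Smoothness of compositions of bundle homomorphisms. -/

section BundleComp

open Bundle ContinuousLinearMap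

variable {d : ℕ} {M : Type*} [TopologicalSpace M] [ChartedSpace (EuclideanSpace ℝ (Fin d)) M]
  {F₁ F₂ F₃ : Type*} [NormedAddCommGroup F₁] [NormedSpace ℝ F₁]
  [NormedAddCommGroup F₂] [NormedSpace ℝ F₂] [NormedAddCommGroup F₃] [NormedSpace ℝ F₃]
  {E₁ E₂ E₃ : M → Type*}
  [∀ x, AddCommGroup (E₁ x)] [∀ x, Module ℝ (E₁ x)] [∀ x, TopologicalSpace (E₁ x)]
  [∀ x, AddCommGroup (E₂ x)] [∀ x, Module ℝ (E₂ x)] [∀ x, TopologicalSpace (E₂ x)]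
  [∀ x, AddCommGroup (E₃ x)] [∀ x, Module ℝ (E₃ x)] [∀ x, TopologicalSpace (E₃ x)]
  [TopologicalSpace (TotalSpace F₁ E₁)] [FiberBundle F₁ E₁] [VectorBundle ℝ F₁ E₁]
  [TopologicalSpace (TotalSpace F₂ E₂)] [FiberBundle F₂ E₂] [VectorBundle ℝ F₂ E₂]
  [TopologicalSpace (TotalSpace F₃ E₃)] [FiberBundle F₃ E₃] [VectorBundle ℝ F₃ E₃]
  [∀ x, IsTopologicalAddGroup (E₂ x)] [∀ x, ContinuousSMul ℝ (E₂ x)]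
  [∀ x, IsTopologicalAddGroup (E₃ x)] [∀ x, ContinuousSMul ℝ (E₃ x)]

omit [∀ x, IsTopologicalAddGroup (E₂ x)] [∀ x, ContinuousSMul ℝ (E₂ x)]
  [∀ x, IsTopologicalAddGroup (E₃ x)] [∀ x, ContinuousSMul ℝ (E₃ x)] in
/-- In coordinates, the composition of bundle homomorphisms is the composition. -/
lemma inCoordinates_comp {x₀ x : M} (h : x ∈ (trivializationAt F₂ E₂ x₀).baseSet)
    (B : E₂ x →L[ℝ] E₃ x) (A : E₁ x →L[ℝ] E₂ x) :
    inCoordinates F₁ E₁ F₃ E₃ x₀ x x₀ x (B.comp A) =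
      (inCoordinates F₂ E₂ F₃ E₃ x₀ x x₀ x B).comp (inCoordinates F₁ E₁ F₂ E₂ x₀ x x₀ x A) := by
  ext v
  exact congrArg (fun w => (trivializationAt F₃ E₃ x₀).continuousLinearMapAt ℝ x (B w))
    (Trivialization.symmL_continuousLinearMapAt _ h _).symm

/-- Composition of smooth bundle homomorphisms is smooth. -/
lemma contMDiff_clm_bundle_comp {B : ∀ x, E₂ x →L[ℝ] E₃ x} {A : ∀ x, E₁ x →L[ℝ] E₂ x}
    (hB : ContMDiff (𝓡 d) ((𝓡 d).prod 𝓘(ℝ, F₂ →L[ℝ] F₃)) ∞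
      fun x => TotalSpace.mk' (F₂ →L[ℝ] F₃) (E := fun x => E₂ x →L[ℝ] E₃ x) x (B x))
    (hA : ContMDiff (𝓡 d) ((𝓡 d).prod 𝓘(ℝ, F₁ →L[ℝ] F₂)) ∞
      fun x => TotalSpace.mk' (F₁ →L[ℝ] F₂) (E := fun x => E₁ x →L[ℝ] E₂ x) x (A x)) :
    ContMDiff (𝓡 d) ((𝓡 d).prod 𝓘(ℝ, F₁ →L[ℝ] F₃)) ∞
      fun x => TotalSpace.mk' (F₁ →L[ℝ] F₃) (E := fun x => E₁ x →L[ℝ] E₃ x) x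
        ((B x).comp (A x)) := by
  intro x₀
  have hB' := ((contMDiffAt_hom_bundle _).1 (hB x₀)).2
  have hA' := ((contMDiffAt_hom_bundle _).1 (hA x₀)).2
  refine (contMDiffAt_hom_bundle _).2 ⟨contMDiffAt_id, (hB'.clm_comp hA').congr_of_eventuallyEq ?_⟩
  filter_upwards [(trivializationAt F₂ E₂ x₀).open_baseSet.mem_nhds
    (FiberBundle.mem_baseSet_trivializationAt' x₀)] with x hx
  exact inCoordinates_comp hx _ _

end BundleComp

/-! ### The algebra of endomorphism fields acting on vector fields. -/

section Fields

variable {d : ℕ} {M : Type*} [TopologicalSpace M]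
  [ChartedSpace (EuclideanSpace ℝ (Fin d)) M] [IsManifold (𝓡 d) ∞ M]

/-- Composition of endomorphism fields. -/
def EndField.comp (A B : EndField d M) : EndField d M where
  toFun x := (A x).comp (B x)
  contMDiff_toFun := contMDiff_clm_bundle_comp A.contMDiff B.contMDiff

/-- The identity endomorphism field. -/
def EndField.id : EndField d M where
  toFun x := ContinuousLinearMap.id ℝ (TangentSpace (𝓡 d) x)
  contMDiff_toFun := by
    intro x₀
    refine (contMDiffAt_hom_bundle _).2 ⟨contMDiffAt_id,
      (contMDiffAt_const (c := ContinuousLinearMap.id ℝ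
        (EuclideanSpace ℝ (Fin d)))).congr_of_eventuallyEq ?_⟩
    filter_upwards [(Bundle.Trivialization.open_baseSet _).mem_nhds
      (FiberBundle.mem_baseSet_trivializationAt' (F := EuclideanSpace ℝ (Fin d))
      (E := fun x : M => TangentSpace (𝓡 d) x) x₀)] with x hx
    ext1 v
    exact Bundle.Trivialization.continuousLinearMapAt_symmL _ hx v

/-- The image of a vector field under an endomorphism field. -/
def EndField.apply (A : EndField d M) (X : VField d M) : VField d M where
  toFun x := A x (X x)
  contMDiff_toFun := A.contMDiff.clm_bundle_apply X.contMDiff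

/-- The action of an endomorphism field on vector fields. -/
def EndField.act (A : EndField d M) : Module.End ℝ (VField d M) where
  toFun := A.apply
  map_add' X Y := by ext x : 1; exact map_add (A x) (X x) (Y x)
  map_smul' c X := by ext x : 1; exact map_smul (A x) c (X x)

/-- A constant-coefficient polynomial in an endomorphism field is an endomorphism field. -/
lemma exists_endField_aeval (R : EndField d M) (p : Polynomial ℝ) :
    ∃ Q : EndField d M, (∀ x, Q x = Polynomial.aeval (R x) p) ∧
      Q.act = Polynomial.aeval R.act p := by
  -- Both descriptions of `Q` are needed: the pointwise one for linear algebra, the action on vector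
  -- fields for the torsion.
  induction p using Polynomial.induction_on' with
  | add p q hp hq =>
    obtain ⟨P, hP, hP'⟩ := hp
    obtain ⟨Q, hQ, hQ'⟩ := hq
    refine ⟨P + Q, fun x => ?_, ?_⟩
    · rw [map_add, ← hP, ← hQ]; rfl
    · rw [map_add, ← hP', ← hQ']; rfl
  | monomial n c =>
    rw [← Polynomial.C_mul_X_pow_eq_monomial]
    induction n with
    | zero =>
      refine ⟨c • EndField.id, fun x => ?_, ?_⟩
      · simp [Algebra.algebraMap_eq_smul_one]; rfl
      · simp [Algebra.algebraMap_eq_smul_one]; rfl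
    | succ n ih =>
      obtain ⟨P, hP, hP'⟩ := ih
      refine ⟨P.comp R, fun x => ?_, ?_⟩
      · rw [pow_succ, ← mul_assoc, map_mul, Polynomial.aeval_X, ← hP]; rfl
      · rw [pow_succ, ← mul_assoc, map_mul, Polynomial.aeval_X, ← hP']; rfl

lemma VField.mdifferentiableAt (X : VField d M) (x : M) :
    MDifferentiableAt (𝓡 d) (𝓡 d).tangent (fun y => (X y : TangentBundle (𝓡 d) M)) x :=
  X.contMDiff.mdifferentiableAt (by simp)

instance : IsManifold (𝓡 d) (minSmoothness ℝ 2) M :=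
  .of_le (n := ∞) (by
    rw [minSmoothness_of_isRCLikeNormedField]
    exact WithTop.coe_le_coe.2 le_top)

instance : IsManifold (𝓡 d) (((⊤ : ℕ∞) : WithTop ℕ∞) + 1) M :=
  inferInstanceAs (IsManifold (𝓡 d) ∞ M)

/-- The Lie bracket of smooth vector fields. -/
def lieBracket : VField d M →ₗ[ℝ] VField d M →ₗ[ℝ] VField d M :=
  LinearMap.mk₂ ℝ
    (fun X Y => ⟨VectorField.mlieBracket (𝓡 d) X Y, fun x =>
      (X.contMDiff x).mlieBracket_vectorField (m := ⊤) (n := ⊤) (Y.contMDiff x) (by simp)⟩)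
    (fun X X' Y => by
      ext x : 1
      exact VectorField.mlieBracket_add_left (X.mdifferentiableAt x) (X'.mdifferentiableAt x))
    (fun c X Y => by
      ext x : 1
      exact VectorField.mlieBracket_const_smul_left (X.mdifferentiableAt x))
    (fun X Y Y' => by
      ext x : 1
      exact VectorField.mlieBracket_add_right (Y.mdifferentiableAt x) (Y'.mdifferentiableAt x))
    (fun c X Y => by
      ext x : 1
      exact VectorField.mlieBracket_const_smul_right (Y.mdifferentiableAt x))

lemma nijenhuis_eq_torsion (S : EndField d M) (X Y : VField d M) (x : M) :
    nijenhuis S X Y x = torsion lieBracket S.act S.act X Y x := by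
  have h : torsion lieBracket S.act S.act X Y x =
    VectorField.mlieBracket (𝓡 d) (fun y => S y (X y)) (fun y => S y (Y y)) x
    - S x (VectorField.mlieBracket (𝓡 d) X (fun y => S y (Y y)) x)
    - S x (VectorField.mlieBracket (𝓡 d) (fun y => S y (X y)) Y x)
    + S x (S x (VectorField.mlieBracket (𝓡 d) X Y x)) := rfl
  rw [h, nijenhuis]
  abel

lemma nijenhuisVanishes_iff (S : EndField d M) :
    NijenhuisVanishes S ↔ ∀ X Y, torsion lieBracket S.act S.act X Y = 0 := by
  simp only [NijenhuisVanishes, nijenhuis_eq_torsion]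
  exact ⟨fun h X Y => by ext x : 1; exact h X Y x, fun h X Y x => by rw [h]; rfl⟩

/-- Constant-coefficient polynomials in a field with vanishing Nijenhuis tensor have vanishing
Nijenhuis tensor. -/
lemma NijenhuisVanishes.aeval {R Q : EndField d M} (hR : NijenhuisVanishes R) {p : Polynomial ℝ}
    (hQ : Q.act = Polynomial.aeval R.act p) : NijenhuisVanishes Q := by
  rw [nijenhuisVanishes_iff] at hR ⊢
  rw [hQ]
  exact torsion_aeval hR p

/-- Every tangent vector is the value of a smooth vector field. -/
lemma exists_vField_apply_eq [T2Space M] (x : M) (v : TangentSpace (𝓡 d) x) :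
    ∃ X : VField d M, X x = v := by
  obtain ⟨s, hs, hsv⟩ := FiberBundle.exists_contMDiffOn_extend (k := ∞) (𝓡 d)
    (EuclideanSpace ℝ (Fin d)) v
  obtain ⟨f, -, hf⟩ := (SmoothBumpFunction.nhds_basis_tsupport (I := 𝓡 d) x).mem_iff.1
    (interior_mem_nhds.2 hs)
  refine ⟨⟨_, ContMDiffOn.smul_section_of_tsupport f.contMDiff.contMDiffOn isOpen_interior hf
    (hsv.mono interior_subset)⟩, ?_⟩
  change f x • FiberBundle.extend (EuclideanSpace ℝ (Fin d)) v x = v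
  rw [f.eq_one, one_smul, FiberBundle.extend_apply_self]

end Fields

/-! ### Brackets and the Nijenhuis tensor in a chart. -/

section Chart

open Bundle Filter Topology

variable {d : ℕ} {M : Type*} [TopologicalSpace M]
  [ChartedSpace (EuclideanSpace ℝ (Fin d)) M]

/-- A vector field with values read in the model space. -/
def modelVec (V : (x : M) → TangentSpace (𝓡 d) x) (x : M) : EuclideanSpace ℝ (Fin d) := V x

/-- The derivative of the inverse of the chart at `x₀`, read in the model space. -/
def chartSymmDeriv (x₀ : M) (p : EuclideanSpace ℝ (Fin d)) :
    EuclideanSpace ℝ (Fin d) →L[ℝ] EuclideanSpace ℝ (Fin d) :=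
  mfderivWithin 𝓘(ℝ, EuclideanSpace ℝ (Fin d)) (𝓡 d) (extChartAt (𝓡 d) x₀).symm
    (Set.range (𝓡 d)) p

/-- The vector field `V` in the chart at `x₀`. -/
def chartField (x₀ : M) (V : (x : M) → TangentSpace (𝓡 d) x) (p : EuclideanSpace ℝ (Fin d)) :
    EuclideanSpace ℝ (Fin d) :=
  (chartSymmDeriv x₀ p).inverse (modelVec V ((extChartAt (𝓡 d) x₀).symm p))

lemma chartField_eq_mpullbackWithin (x₀ : M) (V : (x : M) → TangentSpace (𝓡 d) x) :
    chartField x₀ V = VectorField.mpullbackWithin 𝓘(ℝ, EuclideanSpace ℝ (Fin d)) (𝓡 d)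
      (extChartAt (𝓡 d) x₀).symm V (Set.range (𝓡 d)) := rfl

variable [IsManifold (𝓡 d) ∞ M]

/-- An endomorphism field with values read in the model space. -/
def modelEnd (R : EndField d M) (x : M) :
    EuclideanSpace ℝ (Fin d) →L[ℝ] EuclideanSpace ℝ (Fin d) := R x

/-- The endomorphism field `R` in the chart at `x₀`. -/
def chartEnd (x₀ : M) (R : EndField d M) (p : EuclideanSpace ℝ (Fin d)) :
    EuclideanSpace ℝ (Fin d) →L[ℝ] EuclideanSpace ℝ (Fin d) :=
  (chartSymmDeriv x₀ p).inverse.comp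
    ((modelEnd R ((extChartAt (𝓡 d) x₀).symm p)).comp (chartSymmDeriv x₀ p))

lemma chartSymmDeriv_isInvertible {x₀ : M} {p : EuclideanSpace ℝ (Fin d)}
    (hp : p ∈ (extChartAt (𝓡 d) x₀).target) : (chartSymmDeriv x₀ p).IsInvertible :=
  isInvertible_mfderivWithin_extChartAt_symm hp

lemma chartSymmDeriv_self (x₀ : M) :
    chartSymmDeriv x₀ (extChartAt (𝓡 d) x₀ x₀) = ContinuousLinearMap.id ℝ _ :=
  mfderivWithin_range_extChartAt_symm

lemma chartField_self (x₀ : M) (V : (x : M) → TangentSpace (𝓡 d) x) :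
    chartField x₀ V (extChartAt (𝓡 d) x₀ x₀) = modelVec V x₀ := by
  rw [chartField, chartSymmDeriv_self, ContinuousLinearMap.inverse_id, extChartAt_to_inv]
  rfl

lemma chartEnd_self (x₀ : M) (R : EndField d M) :
    chartEnd x₀ R (extChartAt (𝓡 d) x₀ x₀) = modelEnd R x₀ := by
  rw [chartEnd, chartSymmDeriv_self, ContinuousLinearMap.inverse_id, extChartAt_to_inv]
  rfl

lemma chartField_act {x₀ : M} (R : EndField d M) (V : VField d M) {p : EuclideanSpace ℝ (Fin d)}
    (hp : p ∈ (extChartAt (𝓡 d) x₀).target) :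
    chartField x₀ (R.act V) p = chartEnd x₀ R p (chartField x₀ V p) := by
  obtain ⟨e, he⟩ := chartSymmDeriv_isInvertible hp
  have h : modelVec (R.act V) ((extChartAt (𝓡 d) x₀).symm p) =
    modelEnd R ((extChartAt (𝓡 d) x₀).symm p) (modelVec V ((extChartAt (𝓡 d) x₀).symm p)) := rfl
  simp only [chartField, chartEnd, ← he, ContinuousLinearMap.inverse_equiv, h]
  simp

lemma differentiableAt_chartField (x₀ : M) (V : VField d M) :
    DifferentiableAt ℝ (chartField x₀ V) (extChartAt (𝓡 d) x₀ x₀) := by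
  have h := (V.mdifferentiableAt x₀).mdifferentiableWithinAt (s := Set.univ)
    |>.differentiableWithinAt_mpullbackWithin_vectorField
  rw [← chartField_eq_mpullbackWithin, Set.preimage_univ, Set.univ_inter,
    ModelWithCorners.range_eq_univ] at h
  exact differentiableWithinAt_univ.1 h

/-- At the base point of the chart its derivative is the identity, so no pullback factor survives.
-/
lemma mlieBracket_eq_chart (x₀ : M) (V W : (x : M) → TangentSpace (𝓡 d) x) :
    VectorField.mlieBracket (𝓡 d) V W x₀ =
      fderiv ℝ (chartField x₀ W) (extChartAt (𝓡 d) x₀ x₀) (modelVec V x₀)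
        - fderiv ℝ (chartField x₀ V) (extChartAt (𝓡 d) x₀ x₀) (modelVec W x₀) := by
  have h1 : ∀ u : EuclideanSpace ℝ (Fin d), (mfderiv (𝓡 d) 𝓘(ℝ, EuclideanSpace ℝ (Fin d))
      (extChartAt (𝓡 d) x₀) x₀).inverse u = u := by
    rw [mfderiv_extChartAt_self]
    exact fun u => congrArg (fun f => f u)
      (ContinuousLinearMap.inverse_id (M := EuclideanSpace ℝ (Fin d)) (R := ℝ))
  rw [← VectorField.mlieBracketWithin_univ, VectorField.mlieBracketWithin_apply]
  refine (h1 _).trans ?_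
  rw [← chartField_eq_mpullbackWithin, ← chartField_eq_mpullbackWithin, Set.preimage_univ,
    Set.univ_inter, ModelWithCorners.range_eq_univ, VectorField.lieBracketWithin_univ,
    VectorField.lieBracket, chartField_self, chartField_self]

/-- Transfers the smoothness of `R` as a bundle section to `chartEnd`. -/
lemma chartEnd_eq_inCoordinates {x₀ x : M} (R : EndField d M)
    (hx : x ∈ (chartAt (EuclideanSpace ℝ (Fin d)) x₀).source) :
    chartEnd x₀ R (extChartAt (𝓡 d) x₀ x) =
      ContinuousLinearMap.inCoordinates (EuclideanSpace ℝ (Fin d))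
        (fun x : M => TangentSpace (𝓡 d) x) (EuclideanSpace ℝ (Fin d))
        (fun x : M => TangentSpace (𝓡 d) x) x₀ x x₀ x (R x) := by
  let t := trivializationAt (EuclideanSpace ℝ (Fin d)) (fun x : M => TangentSpace (𝓡 d) x) x₀
  have ht : x ∈ t.baseSet := hx
  have h1 : chartSymmDeriv x₀ (extChartAt (𝓡 d) x₀ x) = t.symmL ℝ x :=
    (TangentBundle.symmL_trivializationAt hx).symm
  have h2 : (chartSymmDeriv x₀ (extChartAt (𝓡 d) x₀ x)).inverse = t.continuousLinearMapAt ℝ x := by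
    obtain ⟨e, he⟩ := chartSymmDeriv_isInvertible
      ((extChartAt (𝓡 d) x₀).map_source (by rwa [extChartAt_source]) :
        extChartAt (𝓡 d) x₀ x ∈ (extChartAt (𝓡 d) x₀).target)
    rw [← he, ContinuousLinearMap.inverse_equiv]
    ext1 u
    obtain ⟨w, rfl⟩ := e.surjective u
    have h3 : e w = t.symmL ℝ x w := congrArg (fun f => f w) (he.trans h1)
    have h4 : t.continuousLinearMapAt ℝ x (t.symmL ℝ x w) = w :=
      t.continuousLinearMapAt_symmL ht w
    rw [h3]
    exact (by rw [← h3]; exact e.symm_apply_apply w : e.symm (t.symmL ℝ x w) = w).trans h4.symm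
  rw [chartEnd, h2, h1, (extChartAt (𝓡 d) x₀).left_inv (by rwa [extChartAt_source])]
  rfl

lemma contMDiffAt_chartEnd_comp (x₀ : M) (R : EndField d M) :
    ContMDiffAt (𝓡 d) 𝓘(ℝ, EuclideanSpace ℝ (Fin d) →L[ℝ] EuclideanSpace ℝ (Fin d)) ∞
      (fun x => chartEnd x₀ R (extChartAt (𝓡 d) x₀ x)) x₀ := by
  refine (((contMDiffAt_hom_bundle _).1 (R.contMDiff x₀)).2).congr_of_eventuallyEq ?_
  filter_upwards [chart_source_mem_nhds (EuclideanSpace ℝ (Fin d)) x₀] with x hx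
  exact chartEnd_eq_inCoordinates R hx

lemma differentiableAt_chartEnd (x₀ : M) (R : EndField d M) :
    DifferentiableAt ℝ (chartEnd x₀ R) (extChartAt (𝓡 d) x₀ x₀) := by
  have h := (contMDiffAt_chartEnd_comp x₀ R).mdifferentiableAt (by simp)
  have hsymm : MDifferentiableAt 𝓘(ℝ, EuclideanSpace ℝ (Fin d)) (𝓡 d) (extChartAt (𝓡 d) x₀).symm
      (extChartAt (𝓡 d) x₀ x₀) :=
    ((contMDiffOn_extChartAt_symm (n := ∞) x₀).contMDiffAt
      (extChartAt_target_mem_nhds x₀)).mdifferentiableAt (by simp)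
  refine (MDifferentiableAt.comp_of_eq _ h hsymm
    (extChartAt_to_inv x₀)).differentiableAt.congr_of_eventuallyEq ?_
  filter_upwards [extChartAt_target_mem_nhds (I := 𝓡 d) x₀] with p hp
  simp only [Function.comp_apply, (extChartAt (𝓡 d) x₀).right_inv hp]

/-- The coordinate expression of the Nijenhuis tensor. -/
lemma chart_torsion_eq_zero [T2Space M] {R : EndField d M} (hR : NijenhuisVanishes R) (x₀ : M)
    (v w : EuclideanSpace ℝ (Fin d)) :
    fderiv ℝ (chartEnd x₀ R) (extChartAt (𝓡 d) x₀ x₀) (modelEnd R x₀ v) w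
      - fderiv ℝ (chartEnd x₀ R) (extChartAt (𝓡 d) x₀ x₀) (modelEnd R x₀ w) v
      - modelEnd R x₀ (fderiv ℝ (chartEnd x₀ R) (extChartAt (𝓡 d) x₀ x₀) v w)
      + modelEnd R x₀ (fderiv ℝ (chartEnd x₀ R) (extChartAt (𝓡 d) x₀ x₀) w v) = 0 := by
  obtain ⟨X, hX⟩ := exists_vField_apply_eq x₀ v
  obtain ⟨Y, hY⟩ := exists_vField_apply_eq x₀ w
  have hX' : modelVec X x₀ = v := hX
  have hY' : modelVec Y x₀ = w := hY
  have hact : ∀ V : VField d M, modelVec (R.act V) x₀ = modelEnd R x₀ (modelVec V x₀) :=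
    fun V => rfl
  have hD : ∀ V : VField d M, ∀ u, fderiv ℝ (chartField x₀ (R.act V)) (extChartAt (𝓡 d) x₀ x₀) u =
      fderiv ℝ (chartEnd x₀ R) (extChartAt (𝓡 d) x₀ x₀) u (modelVec V x₀)
        + modelEnd R x₀ (fderiv ℝ (chartField x₀ V) (extChartAt (𝓡 d) x₀ x₀) u) := fun V u => by
    have h1 : chartField x₀ (R.act V) =ᶠ[𝓝 (extChartAt (𝓡 d) x₀ x₀)]
        fun p => chartEnd x₀ R p (chartField x₀ V p) := by
      filter_upwards [extChartAt_target_mem_nhds (I := 𝓡 d) x₀] with p hp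
      exact chartField_act R V hp
    rw [h1.fderiv_eq, fderiv_clm_apply (differentiableAt_chartEnd x₀ R)
      (differentiableAt_chartField x₀ V), chartEnd_self, chartField_self]
    simp [add_comm]
  let B : VField d M → VField d M → EuclideanSpace ℝ (Fin d) := fun V W =>
    VectorField.mlieBracket (𝓡 d) V W x₀
  have hB : ∀ V W, B V W = fderiv ℝ (chartField x₀ W) (extChartAt (𝓡 d) x₀ x₀) (modelVec V x₀)
        - fderiv ℝ (chartField x₀ V) (extChartAt (𝓡 d) x₀ x₀) (modelVec W x₀) :=
    fun V W => mlieBracket_eq_chart x₀ V W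
  have h : B (R.act X) (R.act Y) - modelEnd R x₀ (B X (R.act Y)) - modelEnd R x₀ (B (R.act X) Y)
      + modelEnd R x₀ (modelEnd R x₀ (B X Y)) = 0 :=
    (nijenhuis_eq_torsion R X Y x₀).symm.trans (hR X Y x₀)
  -- Derivatives of `X` and `Y` cancel (tensoriality), leaving only those of `R`.
  simp only [hB, hD, hact, hX', hY', map_add, map_sub] at h
  rw [← h]
  abel

end Chart

/-! ### Derivatives of traces of powers. -/

section PowTrace

variable {E F : Type*} [NormedAddCommGroup E] [NormedSpace ℝ E] [FiniteDimensional ℝ E]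
  [NormedAddCommGroup F] [NormedSpace ℝ F]

/-- The trace of an endomorphism as a continuous linear functional. -/
def clmTrace (E : Type*) [NormedAddCommGroup E] [NormedSpace ℝ E] [FiniteDimensional ℝ E] :
    (E →L[ℝ] E) →L[ℝ] ℝ :=
  LinearMap.toContinuousLinearMap (LinearMap.trace ℝ E ∘ₗ ContinuousLinearMap.coeLM ℝ)

lemma clmTrace_apply (A : E →L[ℝ] E) : clmTrace E A = LinearMap.trace ℝ E (A : E →ₗ[ℝ] E) := rfl

lemma clmTrace_mul_comm (A B : E →L[ℝ] E) : clmTrace E (A * B) = clmTrace E (B * A) :=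
  LinearMap.trace_mul_comm ℝ (A : E →ₗ[ℝ] E) (B : E →ₗ[ℝ] E)

lemma clmTrace_conj {e e' : E →L[ℝ] E} (h : e' * e = 1) (h2 : e * e' = 1) (A : E →L[ℝ] E) (k : ℕ) :
    clmTrace E ((e * A * e') ^ k) = clmTrace E (A ^ k) := by
  have h1 : (e * A * e') ^ k * e = e * A ^ k := by
    induction k with
    | zero => simp
    | succ k ih =>
      rw [pow_succ, mul_assoc, mul_assoc (e * A), h, mul_one, ← mul_assoc, ih, pow_succ, mul_assoc]
  rw [← mul_one ((e * A * e') ^ k), ← h2, ← mul_assoc, h1, mul_assoc, clmTrace_mul_comm, mul_assoc,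
    h, mul_one]

/-- The product rule gives `k + 1` summands, which have the same trace by cyclicity. -/
lemma hasFDerivAt_clmTrace_pow {A : F → E →L[ℝ] E} {A' : F →L[ℝ] E →L[ℝ] E} {p : F}
    (hA : HasFDerivAt A A' p) (k : ℕ) :
    ∃ T : F →L[ℝ] ℝ, HasFDerivAt (fun q => clmTrace E (A q ^ (k + 1))) T p ∧
      ∀ v, T v = (k + 1) * clmTrace E (A p ^ k * A' v) := by
  refine ⟨_, (clmTrace E).hasFDerivAt.comp p (hA.pow' (k + 1)), fun v => ?_⟩
  simp only [ContinuousLinearMap.comp_apply, sum_apply, map_sum]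
  have : ∀ i ∈ Finset.range (k + 1),
      clmTrace E ((MulOpposite.op (A p ^ i) • A p ^ ((k + 1).pred - i) • A') v)
        = clmTrace E (A p ^ k * A' v) := by
    intro i hi
    have hi' : i ≤ k := Nat.lt_succ_iff.1 (Finset.mem_range.1 hi)
    change clmTrace E (A p ^ (k - i) * A' v * A p ^ i) = _
    rw [clmTrace_mul_comm, ← mul_assoc, ← pow_add, Nat.add_sub_cancel' hi']
  rw [Finset.sum_congr rfl this]
  simp

lemma clmTrace_pow_mul_of_torsion_free {a : E →L[ℝ] E} {D : E →L[ℝ] E →L[ℝ] E}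
    (h : ∀ v w, D (a v) w - D (a w) v - a (D v w) + a (D w v) = 0) (k : ℕ) (v : E) :
    clmTrace E (a ^ k * D (a v)) = clmTrace E (a ^ (k + 1) * D v) := by
  have := trace_pow_mul_of_torsion_free (a := (a : E →ₗ[ℝ] E))
    (D := ContinuousLinearMap.coeLM ℝ ∘ₗ (D : E →ₗ[ℝ] E →L[ℝ] E)) h k v
  rw [← ContinuousLinearMap.toLinearMap_pow, ← ContinuousLinearMap.toLinearMap_pow] at this
  exact this

end PowTrace

/-! ### Constancy of the traces of even powers. -/

section LocallyConstant

open Filter Topology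

variable {d : ℕ} {M : Type*} [TopologicalSpace M]
  [ChartedSpace (EuclideanSpace ℝ (Fin d)) M] [IsManifold (𝓡 d) ∞ M]

/-- A function with vanishing derivative on a connected manifold is constant. -/
lemma eq_of_hasMFDerivAt_zero [PreconnectedSpace M] {f : M → ℝ}
    (hf : ∀ x, HasMFDerivAt (𝓡 d) 𝓘(ℝ, ℝ) f x 0) (x y : M) : f x = f y := by
  refine IsLocallyConstant.apply_eq_of_preconnectedSpace ?_ x y
  rw [IsLocallyConstant.iff_eventually_eq]
  intro x₀
  have hderiv : ∀ p ∈ (extChartAt (𝓡 d) x₀).target,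
      HasFDerivAt (f ∘ (extChartAt (𝓡 d) x₀).symm) (0 : EuclideanSpace ℝ (Fin d) →L[ℝ] ℝ) p := by
    intro p hp
    have hsymm : MDifferentiableAt 𝓘(ℝ, EuclideanSpace ℝ (Fin d)) (𝓡 d)
        (extChartAt (𝓡 d) x₀).symm p :=
      ((contMDiffOn_extChartAt_symm (n := ∞) x₀).contMDiffAt
        ((isOpen_extChartAt_target x₀).mem_nhds hp)).mdifferentiableAt (by simp)
    have h := (hf ((extChartAt (𝓡 d) x₀).symm p)).comp p hsymm.hasMFDerivAt
    exact h.hasFDerivAt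
  obtain ⟨ε, hε, hball⟩ := Metric.mem_nhds_iff.1 (extChartAt_target_mem_nhds (I := 𝓡 d) x₀)
  have hconst : ∀ p ∈ Metric.ball (extChartAt (𝓡 d) x₀ x₀) ε,
      f ((extChartAt (𝓡 d) x₀).symm p) = f x₀ := by
    intro p hp
    have := (convex_ball (extChartAt (𝓡 d) x₀ x₀) ε).is_const_of_fderivWithin_eq_zero (𝕜 := ℝ)
      (f := f ∘ (extChartAt (𝓡 d) x₀).symm)
      (fun q hq => (hderiv q (hball hq)).differentiableAt.differentiableWithinAt)
      (fun q hq => by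
        rw [fderivWithin_of_isOpen Metric.isOpen_ball hq, (hderiv q (hball hq)).fderiv])
      hp (Metric.mem_ball_self hε)
    simpa using this
  filter_upwards [(continuousAt_extChartAt (I := 𝓡 d) x₀).preimage_mem_nhds
    (Metric.ball_mem_nhds _ hε), extChartAt_source_mem_nhds (I := 𝓡 d) x₀] with y hy hy'
  have := hconst _ hy
  rwa [(extChartAt (𝓡 d) x₀).left_inv hy'] at this

variable [T2Space M]

/-- The trace of an even power of `R` is constant, if `R` has vanishing Nijenhuis tensor, is
invertible, and has odd powers of trace zero. -/
lemma clmTrace_modelEnd_pow_eq [PreconnectedSpace M] {R : EndField d M} (hR : NijenhuisVanishes R)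
    (hsurj : ∀ x, Function.Surjective (modelEnd R x))
    (hodd : ∀ x k, Odd k → clmTrace _ (modelEnd R x ^ k) = 0) (m : ℕ) (x y : M) :
    clmTrace _ (modelEnd R x ^ (2 * m)) = clmTrace _ (modelEnd R y ^ (2 * m)) := by
  rcases m with _ | m
  · simp
  refine eq_of_hasMFDerivAt_zero (d := d) (f := fun x => clmTrace _ (modelEnd R x ^ (2 * (m + 1))))
    (fun x₀ => ?_) x y
  let p₀ := extChartAt (𝓡 d) x₀ x₀
  have hD := (differentiableAt_chartEnd x₀ R).hasFDerivAt
  -- `chartEnd` is conjugate to `modelEnd`, so traces of powers may be computed in the chart.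
  have hloc : ∀ k, ∀ x ∈ (extChartAt (𝓡 d) x₀).source,
      clmTrace _ (modelEnd R x ^ k) = clmTrace _ (chartEnd x₀ R (extChartAt (𝓡 d) x₀ x) ^ k) := by
    intro k x hx
    obtain ⟨e, he⟩ := chartSymmDeriv_isInvertible ((extChartAt (𝓡 d) x₀).map_source hx)
    rw [chartEnd, ← he, ContinuousLinearMap.inverse_equiv, (extChartAt (𝓡 d) x₀).left_inv hx]
    refine (clmTrace_conj (e := (e.symm : _ →L[ℝ] _)) (e' := (e : _ →L[ℝ] _)) ?_ ?_ _ k).symm.trans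
      ?_
    · ext1 u
      simp
    · ext1 u
      simp
    · rfl
  -- Obtained by differentiating `tr R^(2m+3) = 0`.
  have key : ∀ v, clmTrace _ (modelEnd R x₀ ^ (2 * m + 2) *
      fderiv ℝ (chartEnd x₀ R) p₀ v) = 0 := by
    intro v
    obtain ⟨T, hT, hT'⟩ := hasFDerivAt_clmTrace_pow hD (2 * m + 2)
    have h0 : (fun q => clmTrace _ (chartEnd x₀ R q ^ (2 * m + 2 + 1))) =ᶠ[𝓝 p₀] fun _ => 0 := by
      filter_upwards [extChartAt_target_mem_nhds (I := 𝓡 d) x₀] with q hq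
      have := hloc (2 * m + 2 + 1) _ ((extChartAt (𝓡 d) x₀).map_target hq)
      rw [(extChartAt (𝓡 d) x₀).right_inv hq] at this
      rw [← this]
      exact hodd _ _ ⟨m + 1, by ring⟩
    have hT0 : T = 0 := hT.unique ((hasFDerivAt_const 0 p₀).congr_of_eventuallyEq h0)
    have := hT' v
    rw [hT0, chartEnd_self] at this
    have hne : (((2 * m + 2 : ℕ) : ℝ) + 1) ≠ 0 := by positivity
    exact (mul_eq_zero.1 this.symm).resolve_left hne
  obtain ⟨T, hT, hT'⟩ := hasFDerivAt_clmTrace_pow hD (2 * m + 1)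
  -- Writing the direction as `R u`, the torsion identity raises the exponent `2m+1` to `2m+2`,
  -- where `key` applies.
  have hT0 : T = 0 := by
    ext v
    obtain ⟨u, rfl⟩ := hsurj x₀ v
    rw [hT', chartEnd_self]
    have h2 := (clmTrace_pow_mul_of_torsion_free (chart_torsion_eq_zero hR x₀) (2 * m + 1) u).trans
      (key u)
    rw [h2, mul_zero]; rfl
  subst hT0
  have h := hT.hasMFDerivAt.comp x₀ (mdifferentiableAt_extChartAt (I := 𝓡 d)
    (mem_chart_source (EuclideanSpace ℝ (Fin d)) x₀)).hasMFDerivAt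
  refine (h.congr_mfderiv (ContinuousLinearMap.zero_comp _)).congr_of_eventuallyEq ?_
  filter_upwards [extChartAt_source_mem_nhds (I := 𝓡 d) x₀] with x hx
  exact hloc _ x hx

end LocallyConstant

/-! ### The almost complex structure as a polynomial in one skew endomorphism. -/

section Pointwise

open Polynomial

variable {V : Type*} [AddCommGroup V] [Module ℝ V]

lemma aeval_symm {g : V →ₗ[ℝ] V →ₗ[ℝ] ℝ} {S : Module.End ℝ V}
    (hS : ∀ v w, g (S v) w = g v (S w)) (p : ℝ[X]) (v w : V) :
    g (aeval S p v) w = g v (aeval S p w) := by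
  induction p using Polynomial.induction_on' generalizing v w with
  | add p q hp hq => simp [hp, hq]
  | monomial n c =>
    simp only [aeval_monomial, Module.End.mul_apply, Module.algebraMap_end_apply, map_smul,
      LinearMap.smul_apply]
    congr 1
    induction n generalizing v w with
    | zero => simp
    | succ n ih =>
      rw [pow_succ, Module.End.mul_apply, ih, hS, ← Module.End.mul_apply S, ← pow_succ']
      rfl

lemma trace_aeval_eq {W : Type*} [AddCommGroup W] [Module ℝ W] {S : Module.End ℝ V}
    {T : Module.End ℝ W} (h : ∀ m : ℕ, LinearMap.trace ℝ V (S ^ m) = LinearMap.trace ℝ W (T ^ m))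
    (p : ℝ[X]) : LinearMap.trace ℝ V (aeval S p) = LinearMap.trace ℝ W (aeval T p) := by
  induction p using Polynomial.induction_on' with
  | add p q hp hq => simp [hp, hq]
  | monomial n c => simp [aeval_monomial, Algebra.algebraMap_eq_smul_one, h]

/-- The polynomial expressing the almost complex structure in terms of `R`. -/
def structurePoly (r : ℝ[X]) : ℝ[X] := X * (r ^ 2).comp (-X ^ 2)

variable {g κ : V →ₗ[ℝ] V →ₗ[ℝ] ℝ} {a : Module.End ℝ V}

section Skew

variable (hg : ∀ v, v ≠ 0 → 0 < g v v)
  (ha : ∀ v w, g (a v) w = - g v (a w))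

include ha in
lemma neg_sq_symm (v w : V) : g ((-a ^ 2) v) w = g v ((-a ^ 2) w) := by
  simp [sq, ha]

include ha hg in
lemma neg_sq_pos (hinj : ∀ v, a v = 0 → v = 0) (v : V) (hv : v ≠ 0) : 0 < g ((-a ^ 2) v) v := by
  have := hg (a v) fun h => hv (hinj v h)
  simpa [sq, ha (a v)] using this

lemma aeval_structurePoly (r : ℝ[X]) :
    aeval a (structurePoly r) = a * aeval (-a ^ 2) r ^ 2 := by
  simp [structurePoly, aeval_comp]

lemma mul_aeval_pow_four {P r : ℝ[X]} (hP : aeval (-a ^ 2) P = 0) (hr : P ∣ X * r ^ 4 - 1) :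
    -a ^ 2 * aeval (-a ^ 2) r ^ 4 = 1 := by
  obtain ⟨s, hs⟩ := hr
  have := congrArg (aeval (-a ^ 2)) hs
  simp only [map_sub, map_mul, map_pow, aeval_X, map_one, hP, zero_mul] at this
  exact sub_eq_zero.1 this

lemma aeval_structurePoly_sq {P r : ℝ[X]} (hP : aeval (-a ^ 2) P = 0) (hr : P ∣ X * r ^ 4 - 1)
    (v : V) : aeval a (structurePoly r) (aeval a (structurePoly r) v) = -v := by
  have h1 : Commute a (aeval (-a ^ 2) r ^ 2) := by
    have : aeval (-a ^ 2) r ^ 2 = aeval a ((r ^ 2).comp (-X ^ 2)) := by simp [aeval_comp]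
    rw [this]
    have h := (Commute.all (X : ℝ[X]) ((r ^ 2).comp (-X ^ 2))).map (aeval a)
    rwa [aeval_X] at h
  have h2 : aeval a (structurePoly r) * aeval a (structurePoly r) = -1 := by
    rw [aeval_structurePoly, mul_assoc, ← mul_assoc (_ ^ 2) a, ← h1.eq, ← mul_aeval_pow_four hP hr]
    simp only [neg_mul, neg_neg, mul_assoc, ← pow_add, sq a]
  rw [← Module.End.mul_apply, h2]
  simp

include ha in
-- One of the two factors `r(-a²)` is moved across `g` by symmetry; the right side is visibly
-- symmetric and nonnegative on the diagonal.
lemma aeval_structurePoly_form (hκ : ∀ v w, g v w = κ (a v) w) (r : ℝ[X]) (v w : V) :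
    κ (aeval a (structurePoly r) v) w = g (aeval (-a ^ 2) r v) (aeval (-a ^ 2) r w) := by
  rw [aeval_structurePoly, Module.End.mul_apply, ← hκ, sq, Module.End.mul_apply,
    aeval_symm (neg_sq_symm ha)]

lemma aeval_ne_zero {P r : ℝ[X]} (hP : aeval (-a ^ 2) P = 0) (hr : P ∣ X * r ^ 4 - 1)
    {v : V} (hv : v ≠ 0) : aeval (-a ^ 2) r v ≠ 0 := by
  intro h
  apply hv
  have := LinearMap.congr_fun (mul_aeval_pow_four hP hr) v
  rw [pow_succ _ 3, ← mul_assoc, Module.End.mul_apply, h, map_zero] at this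
  simpa using this.symm

end Skew

end Pointwise

/-! ### Boundedness of the unit balls of a positive form. -/

section VonN

/-- The unit balls of a positive definite form on a finite-dimensional space are bounded. -/
lemma isVonNBounded_of_pos {E : Type*} [NormedAddCommGroup E] [NormedSpace ℝ E]
    [FiniteDimensional ℝ E] (B : E →L[ℝ] E →L[ℝ] ℝ) (hB : ∀ v, v ≠ 0 → 0 < B v v) :
    Bornology.IsVonNBounded ℝ {v : E | B v v < 1} := by
  rw [NormedSpace.isVonNBounded_iff]
  have hc : Continuous fun v => B v v := by fun_prop
  obtain ⟨c, hc0, hcB⟩ : ∃ c > 0, ∀ v, c * ‖v‖ ^ 2 ≤ B v v := by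
    rcases subsingleton_or_nontrivial E with h | h
    · exact ⟨1, one_pos, fun v => by simp [Subsingleton.elim v 0]⟩
    · obtain ⟨u, hu, hmin⟩ := (isCompact_sphere (0 : E) 1).exists_isMinOn
        (NormedSpace.sphere_nonempty.2 zero_le_one) hc.continuousOn
      have hu0 : u ≠ 0 := ne_zero_of_mem_unit_sphere ⟨u, hu⟩
      refine ⟨B u u, hB u hu0, fun v => ?_⟩
      by_cases hv : v = 0
      · simp [hv]
      · have hn : ‖v‖ ≠ 0 := norm_ne_zero_iff.2 hv
        have := hmin (show ‖v‖⁻¹ • v ∈ Metric.sphere (0 : E) 1 by simp [norm_smul, hn])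
        simp only [Set.mem_ofPred_eq, map_smul, smul_apply, smul_eq_mul] at this
        calc B u u * ‖v‖ ^ 2 ≤ (‖v‖⁻¹ * (‖v‖⁻¹ * B v v)) * ‖v‖ ^ 2 := by gcongr
          _ = B v v := by field_simp
  -- The radius comes from `‖v‖ ≤ 1 + ‖v‖² ≤ 1 + c⁻¹`.
  refine (Metric.isBounded_closedBall (x := (0 : E)) (r := 1 + c⁻¹)).subset fun v hv => ?_
  rw [mem_closedBall_zero_iff]
  have h1 : ‖v‖ ^ 2 ≤ c⁻¹ := by
    rw [← one_div, le_div_iff₀ hc0, mul_comm]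
    exact (hcB v).trans (le_of_lt hv)
  nlinarith [sq_nonneg (‖v‖ - 1), norm_nonneg v, inv_pos.2 hc0]

end VonN

/-! ### The two implications. -/

section Main

open Polynomial

variable {d : ℕ} {M : Type*} [TopologicalSpace M]
  [ChartedSpace (EuclideanSpace ℝ (Fin d)) M]

/-- A field of bilinear forms, read in the model space. -/
def modelForm (β : (x : M) → TangentSpace (𝓡 d) x →L[ℝ] TangentSpace (𝓡 d) x →L[ℝ] ℝ) (x : M) :
    EuclideanSpace ℝ (Fin d) →ₗ[ℝ] EuclideanSpace ℝ (Fin d) →ₗ[ℝ] ℝ :=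
  let B : EuclideanSpace ℝ (Fin d) →L[ℝ] EuclideanSpace ℝ (Fin d) →L[ℝ] ℝ := β x
  ContinuousLinearMap.coeLM ℝ ∘ₗ B.toLinearMap

variable [IsManifold (𝓡 d) ∞ M]

/-- An endomorphism field, read as linear maps of the model space. -/
def modelLin (R : EndField d M) (x : M) : Module.End ℝ (EuclideanSpace ℝ (Fin d)) :=
  (modelEnd R x).toLinearMap

lemma modelLin_aeval {R Q : EndField d M} {p : ℝ[X]} {x : M} (h : Q x = aeval (R x) p) :
    modelLin Q x = aeval (modelLin R x) p := by
  have h1 : modelEnd Q x = aeval (modelEnd R x) p := h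
  rw [modelLin, h1]
  let φ : (EuclideanSpace ℝ (Fin d) →L[ℝ] EuclideanSpace ℝ (Fin d)) →ₐ[ℝ]
      Module.End ℝ (EuclideanSpace ℝ (Fin d)) :=
    { ContinuousLinearMap.toLinearMapRingHom with commutes' := fun _ => rfl }
  exact (aeval_algHom_apply φ (modelEnd R x) p).symm

/-- The metric `κ(Q·, ·)`, if it is symmetric and positive definite. -/
def metricOf (κ : BilinField d M) (Q : EndField d M)
    (hsymm : ∀ x v w, modelForm κ x (modelLin Q x v) w = modelForm κ x (modelLin Q x w) v)
    (hpos : ∀ x v, v ≠ 0 → 0 < modelForm κ x (modelLin Q x v) v) : RMetric d M where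
  inner x := (κ x).comp (Q x)
  symm := hsymm
  pos := hpos
  isVonNBounded x :=
    isVonNBounded_of_pos (E := EuclideanSpace ℝ (Fin d)) ((κ x).comp (Q x)) (hpos x)
  contMDiff := contMDiff_clm_bundle_comp κ.contMDiff Q.contMDiff

/-- Kähler structures with fundamental form `κ` yield calibrated fields. -/
lemma exists_calibrated_of_kahler {n : ℕ} {M : Type*} [TopologicalSpace M]
    [ChartedSpace (EuclideanSpace ℝ (Fin (2 * n))) M] [IsManifold (𝓡 (2 * n)) ∞ M]
    {κ : BilinField (2 * n) M} {g : RMetric (2 * n) M} {J : EndField (2 * n) M}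
    (h : IsKahler g J)
    (hκ : ∀ (x : M) (u w : TangentSpace (𝓡 (2 * n)) x), κ x u w = g.inner x (J x u) w) :
    ∃ R : EndField (2 * n) M, IsCalibrated κ R ∧ NijenhuisVanishes R := by
  -- The sign is forced: `κ(R·, ·) = g(JR·, ·)` must be `g`.
  refine ⟨-J, ⟨g, fun x u w => ?_, fun x v => ?_⟩, h.integrable.aeval (p := -X) ?_⟩
  · have h1 : (-J) x u = -(J x u) := rfl
    rw [hκ, h1, map_neg, h.sq_eq_neg, neg_neg]
  · have := volumeForm_eq_extPower_div (g := modelForm g.inner x) (J := modelLin J x) (n := n)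
      (g.symm x) (g.pos x) (h.sq_eq_neg x) (h.hermitian x) (by simp) v
    have h2 : (fun u w : EuclideanSpace ℝ (Fin (2 * n)) => modelForm g.inner x (modelLin J x u) w)
        = fun u w => κ x u w := funext fun u => funext fun w => (hκ x u w).symm
    rw [h2] at this
    exact this
  · rw [map_neg, aeval_X]
    rfl

/-- If `R` has vanishing Nijenhuis tensor and `κ(R·, ·)` is a Riemannian metric, then `κ` is the
fundamental form of a Kähler structure. -/
lemma exists_kahler_of_calibrated [T2Space M] [ConnectedSpace M] {κ : BilinField d M}
    (hκ : IsSymplectic κ) {R : EndField d M} {g : RMetric d M}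
    (hg : ∀ (x : M) (u w : TangentSpace (𝓡 d) x), g.inner x u w = κ x (R x u) w)
    (hR : NijenhuisVanishes R) :
    ∃ (g : RMetric d M) (J : EndField d M), IsKahler g J ∧
      ∀ (x : M) (u w : TangentSpace (𝓡 d) x), κ x u w = g.inner x (J x u) w := by
  have hg' : ∀ x v w, modelForm g.inner x v w = modelForm κ x (modelLin R x v) w := hg
  have hsymm : ∀ x v w, modelForm g.inner x v w = modelForm g.inner x w v := g.symm
  have hpos : ∀ x v, v ≠ 0 → 0 < modelForm g.inner x v v := g.pos
  have halt : ∀ x v w, modelForm κ x v w = -modelForm κ x w v := fun x v w => by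
    have h0 : ∀ u, modelForm κ x u u = 0 := hκ.alternating x
    have := h0 (v + w)
    simp only [map_add, LinearMap.add_apply, h0] at this
    linarith
  have hskew : ∀ x v w, modelForm g.inner x (modelLin R x v) w
      = -modelForm g.inner x v (modelLin R x w) := fun x v w => by
    rw [hsymm x _ w, hg', hg', halt x]
  have hinj : ∀ x v, modelLin R x v = 0 → v = 0 := fun x v hv => by
    by_contra h
    exact (hpos x v h).ne' (by rw [hg', hv, map_zero, LinearMap.zero_apply])
  have hsurj : ∀ x, Function.Surjective (modelEnd R x) := fun x =>
    (LinearMap.injective_iff_surjective (f := modelLin R x)).1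
      ((injective_iff_map_eq_zero _).2 (hinj x))
  have htr : ∀ x k, clmTrace _ (modelEnd R x ^ k) = LinearMap.trace ℝ _ (modelLin R x ^ k) :=
    fun x k => by
      rw [clmTrace_apply, ContinuousLinearMap.toLinearMap_pow]; rfl
  have heven := clmTrace_modelEnd_pow_eq hR hsurj fun x k hk => by
    rw [htr]
    exact trace_pow_eq_zero_of_skew (hpos x) (hskew x) hk
  have htrS : ∀ x y m, LinearMap.trace ℝ _ ((-modelLin R x ^ 2) ^ m)
      = LinearMap.trace ℝ _ ((-modelLin R y ^ 2) ^ m) := fun x y m => by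
    have := heven m x y
    rw [htr, htr] at this
    rw [neg_pow, neg_pow (modelLin R y ^ 2), ← pow_mul, ← pow_mul]
    rcases neg_one_pow_eq_or (Module.End ℝ (EuclideanSpace ℝ (Fin d))) m with h | h <;>
      simp [h, this]
  obtain ⟨x₀⟩ : Nonempty M := inferInstance
  obtain ⟨Λ, hΛ, hP₀⟩ := exists_finset_aeval_prod_eq_zero (hsymm x₀) (hpos x₀)
    (neg_sq_symm (hskew x₀)) (neg_sq_pos (hpos x₀) (hskew x₀) (hinj x₀))
  -- The symmetric endomorphism `p(S)` has `tr p(S)²` independent of the point and zero at `x₀`;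
  -- hence it vanishes everywhere.
  have hP : ∀ x, aeval (-modelLin R x ^ 2) (∏ l ∈ Λ, (X - C l)) = 0 := fun x => by
    refine eq_zero_of_trace_sq_eq_zero (hsymm x) (hpos x)
      (aeval_symm (neg_sq_symm (hskew x)) _) ?_
    rw [← map_mul, trace_aeval_eq (htrS x x₀), map_mul, hP₀, mul_zero, map_zero]
  obtain ⟨r, hr⟩ := exists_polynomial_dvd Λ hΛ
  obtain ⟨Q, hQ, hQact⟩ := exists_endField_aeval R (structurePoly r)
  have hQ' : ∀ x, modelLin Q x = aeval (modelLin R x) (structurePoly r) :=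
    fun x => modelLin_aeval (hQ x)
  have hQsq : ∀ x v, modelLin Q x (modelLin Q x v) = -v := fun x v => by
    rw [hQ']
    exact aeval_structurePoly_sq (hP x) hr v
  have hQform : ∀ x v w, modelForm κ x (modelLin Q x v) w = modelForm g.inner x
      (aeval (-modelLin R x ^ 2) r v) (aeval (-modelLin R x ^ 2) r w) := fun x v w => by
    rw [hQ']
    exact aeval_structurePoly_form (hskew x) (hg' x) r v w
  have hQsymm : ∀ x v w, modelForm κ x (modelLin Q x v) w = modelForm κ x (modelLin Q x w) v :=
    fun x v w => by rw [hQform, hQform, hsymm]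
  have hQpos : ∀ x v, v ≠ 0 → 0 < modelForm κ x (modelLin Q x v) v := fun x v hv => by
    rw [hQform]
    exact hpos x _ (aeval_ne_zero (hP x) hr hv)
  have hfund : ∀ x v w, modelForm κ x (modelLin Q x (-modelLin Q x v)) w = modelForm κ x v w :=
    fun x v w => by rw [map_neg, hQsq, neg_neg]
  -- The metric `κ(Q·, ·)` has fundamental form `κ(QJ·, ·)`, which is `κ` exactly when `J = Q⁻¹ =
  -- -Q`.
  refine ⟨metricOf κ Q hQsymm hQpos, -Q, ⟨fun x => ?_, fun x => ?_, ?_, ?_⟩, ?_⟩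
  · have : ∀ u, -modelLin Q x (-modelLin Q x u) = -u := fun u => by
      rw [map_neg, hQsq, neg_neg]
    exact this
  · have : ∀ u w, modelForm κ x (modelLin Q x (-modelLin Q x u)) (-modelLin Q x w)
        = modelForm κ x (modelLin Q x u) w := fun u w => by
      rw [hfund, map_neg, halt x, neg_neg, hQsymm]
    exact this
  · refine hR.aeval (p := -structurePoly r) ?_
    rw [map_neg, ← hQact]
    rfl
  · have : fundamentalForm (metricOf κ Q hQsymm hQpos) (-Q) = fun x => κ x :=
      funext fun x => ContinuousLinearMap.ext fun u => ContinuousLinearMap.ext fun w =>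
        hfund x u w
    rw [this]
    exact hκ.closed
  · exact fun x u w => (hfund x u w).symm

end Main

end SymplecticManifold

end

theorem mainTheorem2 (n : ℕ) {M : Type*} [TopologicalSpace M]
    [ChartedSpace (EuclideanSpace ℝ (Fin (2 * n))) M] [IsManifold (𝓡 (2 * n)) ∞ M]
    [T2Space M] [SecondCountableTopology M] [ConnectedSpace M]
    (κ : SymplecticManifold.BilinField (2 * n) M) (hκ : SymplecticManifold.IsSymplectic κ) :
    (∃ (g : SymplecticManifold.RMetric (2 * n) M) (J : SymplecticManifold.EndField (2 * n) M),
      SymplecticManifold.IsKahler g J ∧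
        ∀ (x : M) (u w : TangentSpace (𝓡 (2 * n)) x), κ x u w = g.inner x (J x u) w) ↔
    ∃ R : SymplecticManifold.EndField (2 * n) M,
      SymplecticManifold.IsCalibrated κ R ∧ SymplecticManifold.NijenhuisVanishes R := by
  constructor
  · rintro ⟨g, J, h, hJ⟩
    exact SymplecticManifold.exists_calibrated_of_kahler h hJ
  · rintro ⟨R, ⟨g, hg, -⟩, hR⟩
    exact SymplecticManifold.exists_kahler_of_calibrated hκ hg hR
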